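/- For $s\in\mathbb N_+$ and $\gamma\in\mathbb R$ consider the system with $s$ parallel servers, Poisson arrivals with rate $\lambda=s-\gamma\sqrt s$ (where $\lambda\ge 0$), exponential service times with mean one, and an admission control policy $p_s(k)\in[0,1]$, $k\ge 0$: an arriving customer that finds $k\ge s$ customers in the system joins with probability $p_s(k-s)$ and is rejected otherwise. Put $\rho=\lambda/s$ and $F_s(\rho)=\sum_{n\ge0}p_s(0)\cdots p_s(n)\,\rho^{n+1}$. If $F_s(\rho)<\infty$, the stationary distribution of the number of customers is $$\pi_s(k)=Z^{-1}\frac{(s\rho)^k}{k!}\ (0\le k\le s),\qquad \pi_s(k)=Z^{-1}\frac{s^s\rho^k}{s!}\prod_{i=0}^{k-s-1}p_s(i)\ (k>s),$$ with $Z=\sum_{k=0}^s (s\rho)^k/k!+\frac{(s\rho)^s}{s!}F_s(\rho)$. Let $D_s(\gamma)=\sum_{k\ge s}\pi_s(k)$ be the delay probability. Let $\Gamma=[\gamma_l,\gamma_r]$ be a compact interval with $\inf\{\gamma\in\mathbb R: F_s(\rho)<\infty\}<\gamma_l$ for all large $s$, let $\varepsilon\in(0,1)$ and let $j\in\{0,1,2,\dots\}$.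 Assume that the delay probability has an asymptotic expansion of order $j$ in powers of $s^{-1/2}$, uniformly on $\Gamma$: there are functions $D_0,\dots,D_j$ on $\Gamma$ (not depending on $s$) such that $$\sup_{\gamma\in\Gamma}\Bigl|D_s(\gamma)-\sum_{i=0}^j\frac{D_i(\gamma)}{s^{i/2}}\Bigr|=O\bigl(s^{-(j+1)/2}\bigr)\qquad(s\to\infty),$$ and that $D_0,\dots,D_j$ are differentiable on $\Gamma$ with bounded derivatives. Assume also that $D_0(\gamma_0)=\varepsilon$ for some $\gamma_0$ in the interior of $\Gamma$. Then there are finite constants $M_j,K_j>0$, independent of $s$, and $s_j\in\mathbb N_+$ such that for all $s\ge s_j$ the equation $\sum_{i=0}^jD_i(\gamma)/s^{i/2}=\varepsilon$ has exactly one solution $\gamma_{j,s}\in\Gamma$, the equation $D_s(\gamma)=\varepsilon$ has exactly one solution $\gamma_s^*\in\Gamma$, and $$|D_s(\gamma_{j,s})-\varepsilon|\le\frac{M_j}{s^{(j+1)/2}},\qquad |\gamma_{j,s}-\gamma_s^*|\le\frac{K_j}{s^{(j+1)/2}}.$$ -/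

import Mathlib

open Filter Set

namespace AdmissionQueue

noncomputable section

/-- Arrival rate `λ = s - γ √s`. -/
def arrivalRate (s : ℕ) (γ : ℝ) : ℝ := (s : ℝ) - γ * Real.sqrt s

/-- Relative load `ρ = λ / s`. -/
def load (s : ℕ) (γ : ℝ) : ℝ := arrivalRate s γ / s

/-- The terms `p(0) ⋯ p(n) ρ ^ (n + 1)` of the series `F`. -/
def queueTerm (p : ℕ → ℝ) (ρ : ℝ) (n : ℕ) : ℝ :=
  (∏ i ∈ Finset.range (n + 1), p i) * ρ ^ (n + 1)

/-- `F(ρ) = ∑ₙ p(0) ⋯ p(n) ρ ^ (n + 1)`. -/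
def queueSeries (p : ℕ → ℝ) (ρ : ℝ) : ℝ := ∑' n, queueTerm p ρ n

/-- `inf {γ ∈ ℝ | F(ρ) < ∞}`, as an extended real since it can be `-∞`. -/
def gammaMin (p : ℕ → ℝ) (s : ℕ) : EReal :=
  sInf ((fun γ : ℝ => (γ : EReal)) '' {γ : ℝ | Summable (queueTerm p (load s γ))})

/-- The normalizing constant `Z` of the stationary distribution. -/
def normConst (p : ℕ → ℝ) (s : ℕ) (γ : ℝ) : ℝ :=
  ∑ k ∈ Finset.range (s + 1), (s * load s γ) ^ k / (k.factorial : ℝ)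
    + (s * load s γ) ^ s / (s.factorial : ℝ) * queueSeries p (load s γ)

/-- The stationary probability of having `k` customers in the `s`-server system with arrival rate
`s - γ √s`, unit service rates, and in which an arrival that finds `k ≥ s` customers is admitted
with probability `p (k - s)`. -/
def stationary (p : ℕ → ℝ) (s : ℕ) (γ : ℝ) (k : ℕ) : ℝ :=
  if k ≤ s then
    (normConst p s γ)⁻¹ * ((s * load s γ) ^ k / (k.factorial : ℝ))
  else
    (normConst p s γ)⁻¹ * ((s : ℝ) ^ s * load s γ ^ k / (s.factorial : ℝ)
      * ∏ i ∈ Finset.range (k - s), p i)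

/-- The delay probability `∑_{k ≥ s} π(k)`. -/
def delayProb (p : ℕ → ℝ) (s : ℕ) (γ : ℝ) : ℝ :=
  ∑' k : ℕ, if s ≤ k then stationary p s γ k else 0

/-- The `j`-th order truncation `∑_{i=0}^{j} D_i(γ) / s^{i/2}`. -/
def truncatedExpansion (D : ℕ → ℝ → ℝ) (j s : ℕ) (γ : ℝ) : ℝ :=
  ∑ i ∈ Finset.range (j + 1), D i γ / (s : ℝ) ^ ((i : ℝ) / 2)

/-- `γ` is the one and only solution in `Γ` of the equation `g = ε`. -/
def IsUniqueSolution (g : ℝ → ℝ) (Γ : Set ℝ) (ε γ : ℝ) : Prop :=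
  γ ∈ Γ ∧ g γ = ε ∧ ∀ γ' ∈ Γ, g γ' = ε → γ' = γ

end

end AdmissionQueue

namespace AdmissionQueue

/-! Write the delay probability as `(1 + F) / (1 + A + F)`, with `A` = `belowRatio` and `F` =
`queueSeries`; the odds against delay are `A / (1 + F)`. As `γ` grows, `F` decreases and, for large
`s`, `A` grows by a factor at least `1 + c (γ' - γ)` with `c` independent of `s`
(`belowRatio_growth`). Hence `c (γ' - γ) (1 - D_s γ) D_s γ' ≤ D_s γ - D_s γ'`
(`delayProb_regularity`).

This inequality passes to the limit `D 0`, so no separate monotonicity assumption is needed: `D 0`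
is antitone on `Γ`, and near `γ₀`, where it stays away from `0` and `1`, it falls with slope at
least some `q > 0`. Uniform closeness confines solutions to that neighbourhood. There `D_s` inherits
the slope, and the truncation stays strictly decreasing because its corrections have vanishing
Lipschitz constants. Dividing the error in value by `q` bounds the error in `γ`
(`exists_approximate_solution`). -/

/-! ### Growth of the below-capacity ratio in `γ` -/

/-- The ratio of the probabilities of `s - m` and of `s` customers. -/
noncomputable def stateRatio (s : ℕ) (x : ℝ) (m : ℕ) : ℝ := (s.descFactorial m : ℝ) / x ^ m

/-- The ratio of the probability of fewer than `s` customers to that of exactly `s`. -/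
noncomputable def belowRatio (s : ℕ) (x : ℝ) : ℝ := ∑ m ∈ Finset.Icc 1 s, stateRatio s x m

lemma stateRatio_nonneg (s m : ℕ) {x : ℝ} (hx : 0 < x) : 0 ≤ stateRatio s x m := by
  unfold stateRatio; positivity

lemma belowRatio_pos {s : ℕ} (hs : 1 ≤ s) {x : ℝ} (hx : 0 < x) : 0 < belowRatio s x := by
  refine Finset.sum_pos (fun m hm => ?_) ⟨1, by simpa using hs⟩
  have h := (Nat.descFactorial_pos (n := s) (k := m)).2 (Finset.mem_Icc.1 hm).2
  unfold stateRatio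
  positivity

lemma stateRatio_succ {s k : ℕ} (hk : k ≤ s) (x : ℝ) :
    stateRatio s x (k + 1) = ((s : ℝ) - k) / x * stateRatio s x k := by
  unfold stateRatio
  rw [Nat.descFactorial_succ, pow_succ]
  push_cast [Nat.cast_sub hk]
  rw [div_mul_div_comm, mul_comm x]

lemma pow_mul_stateRatio_le {s n : ℕ} {x t : ℝ} (hx : 0 < x) (ht : t ≤ 1)
    (hn : 2 * n ≤ s) (h : (1 - t) * x ≤ s - 2 * n) {m : ℕ} (i : ℕ) (hmi : m + i ≤ 2 * n) :
    (1 - t) ^ i * stateRatio s x m ≤ stateRatio s x (m + i) := by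
  induction i with
  | zero => simp
  | succ i ih =>
    rw [← add_assoc, stateRatio_succ (by omega)]
    have h1 : 1 - t ≤ ((s : ℝ) - (m + i : ℕ)) / x := by
      rw [le_div_iff₀ hx]
      have : ((m + i : ℕ) : ℝ) ≤ ((2 * n : ℕ) : ℝ) := by exact_mod_cast (by omega)
      push_cast at this ⊢
      linarith
    calc (1 - t) ^ (i + 1) * stateRatio s x m
        = (1 - t) * ((1 - t) ^ i * stateRatio s x m) := by ring
      _ ≤ _ := mul_le_mul h1 (ih (by omega))
          (mul_nonneg (pow_nonneg (by linarith) _) (stateRatio_nonneg _ _ hx))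
          (le_trans (by linarith) h1)

/-- The weights up to index `2n` decay by a factor at least `1 - t` per step, so shifting the block
`[1, n]` by `n` at most halves its weights (Bernoulli). Thus at least a third of the mass lies
beyond `n`. -/
lemma belowRatio_le_moment {s n : ℕ} {x t : ℝ} (hx : 0 < x) (ht : t ≤ 1)
    (hn : 2 * n ≤ s) (hnt : n * t ≤ 1 / 2) (h : (1 - t) * x ≤ s - 2 * n) :
    n / 3 * belowRatio s x ≤ ∑ m ∈ Finset.Icc 1 s, m * stateRatio s x m := by
  have hw := fun m => stateRatio_nonneg s m hx
  have hb : 1 / 2 ≤ (1 - t) ^ n := by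
    have := one_add_mul_le_pow (a := -t) (by linarith) n
    have h2 : 1 + -t = 1 - t := by ring
    rw [h2] at this
    linarith
  have hunion : Finset.Icc 1 s = Finset.Icc 1 n ∪ Finset.Icc (n + 1) s := by
    ext m; simp only [Finset.mem_Icc, Finset.mem_union]; omega
  have hdisj : Disjoint (Finset.Icc 1 n) (Finset.Icc (n + 1) s) := by
    rw [Finset.disjoint_left]; intro m; simp only [Finset.mem_Icc]; omega
  have hlow : ∑ m ∈ Finset.Icc 1 n, stateRatio s x m
      ≤ 2 * ∑ m ∈ Finset.Icc (n + 1) s, stateRatio s x m := by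
    calc ∑ m ∈ Finset.Icc 1 n, stateRatio s x m
        ≤ ∑ m ∈ Finset.Icc 1 n, 2 * stateRatio s x (m + n) := by
          refine Finset.sum_le_sum fun m hm => ?_
          have hm' := Finset.mem_Icc.1 hm
          have h3 := pow_mul_stateRatio_le hx ht hn h (m := m) n (by omega)
          have h4 := mul_le_mul_of_nonneg_right hb (hw m)
          linarith
      _ = 2 * ∑ m ∈ (Finset.Icc 1 n).map (addRightEmbedding n), stateRatio s x m := by
          rw [← Finset.mul_sum, Finset.sum_map]; rfl
      _ ≤ _ := by
          refine mul_le_mul_of_nonneg_left (Finset.sum_le_sum_of_subset_of_nonneg ?_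
            fun m _ _ => hw m) (by norm_num)
          rw [Finset.map_add_right_Icc]
          intro m; simp only [Finset.mem_Icc]; omega
  have hhigh : n * ∑ m ∈ Finset.Icc (n + 1) s, stateRatio s x m
      ≤ ∑ m ∈ Finset.Icc 1 s, m * stateRatio s x m := by
    rw [Finset.mul_sum]
    calc ∑ m ∈ Finset.Icc (n + 1) s, n * stateRatio s x m
        ≤ ∑ m ∈ Finset.Icc (n + 1) s, m * stateRatio s x m := by
          refine Finset.sum_le_sum fun m hm => mul_le_mul_of_nonneg_right ?_ (hw m)
          exact_mod_cast (by have := Finset.mem_Icc.1 hm; omega)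
      _ ≤ _ := Finset.sum_le_sum_of_subset_of_nonneg
          (by intro m; simp only [Finset.mem_Icc]; omega)
          (fun m _ _ => mul_nonneg (Nat.cast_nonneg _) (hw m))
  have hsum : belowRatio s x ≤ 3 * ∑ m ∈ Finset.Icc (n + 1) s, stateRatio s x m := by
    unfold belowRatio
    rw [hunion, Finset.sum_union hdisj]
    linarith
  calc n / 3 * belowRatio s x
      ≤ n / 3 * (3 * ∑ m ∈ Finset.Icc (n + 1) s, stateRatio s x m) :=
        mul_le_mul_of_nonneg_left hsum (by positivity)
    _ = n * ∑ m ∈ Finset.Icc (n + 1) s, stateRatio s x m := by ring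
    _ ≤ _ := hhigh

/-- Bernoulli's inequality for `(x / y) ^ m`, term by term: the mean index controls the relative
growth. -/
lemma belowRatio_add_moment_le {s : ℕ} {x y : ℝ} (hy : 0 < y) (hyx : y ≤ x) :
    belowRatio s x + (x - y) / y * ∑ m ∈ Finset.Icc 1 s, m * stateRatio s x m
      ≤ belowRatio s y := by
  unfold belowRatio
  rw [Finset.mul_sum, ← Finset.sum_add_distrib]
  refine Finset.sum_le_sum fun m _ => ?_
  have hx : 0 < x := hy.trans_le hyx
  have h1 : 1 + m * ((x - y) / y) ≤ (x / y) ^ m := by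
    have := one_add_mul_le_pow (a := (x - y) / y)
      (by have := div_nonneg (sub_nonneg.2 hyx) hy.le; linarith) m
    have h2 : 1 + (x - y) / y = x / y := by field_simp; ring
    rwa [h2] at this
  have h3 : stateRatio s y m = (x / y) ^ m * stateRatio s x m := by
    unfold stateRatio; rw [div_pow]; field_simp
  rw [h3]
  have := mul_le_mul_of_nonneg_right h1 (stateRatio_nonneg s m hx)
  linarith

lemma eventually_arrivalRate_pos (G : ℝ) :
    ∀ᶠ s : ℕ in atTop, 1 ≤ s ∧ ∀ γ : ℝ, |γ| ≤ G → 0 < arrivalRate s γ := by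
  have h : Tendsto (fun s : ℕ => Real.sqrt s) atTop atTop :=
    Real.tendsto_sqrt_atTop.comp tendsto_natCast_atTop_atTop
  filter_upwards [h.eventually_gt_atTop G, eventually_ge_atTop 1] with s hs hs1
  refine ⟨hs1, fun γ hγ => ?_⟩
  have hp : 0 < Real.sqrt s := Real.sqrt_pos.2 (by exact_mod_cast hs1)
  have hq : Real.sqrt s * Real.sqrt s = s := Real.mul_self_sqrt (Nat.cast_nonneg _)
  have : 0 < (Real.sqrt s - γ) * Real.sqrt s :=
    mul_pos (by linarith [le_abs_self γ]) hp
  unfold arrivalRate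
  nlinarith

lemma belowRatio_growth (G : ℝ) (hG : 0 ≤ G) :
    ∃ c : ℝ, 0 < c ∧ ∀ᶠ s : ℕ in atTop, ∀ γ γ' : ℝ, |γ| ≤ G → |γ'| ≤ G → γ ≤ γ' →
      (1 + c * (γ' - γ)) * belowRatio s (arrivalRate s γ)
        ≤ belowRatio s (arrivalRate s γ') := by
  -- With `n ≈ d √s` and `t = (G + 2) / √s`, this `d` makes `n t ≤ 1 / 2`. The mean index is then of
  -- order `√s`, matching a relative change of the rate of order `(γ' - γ) / √s`.
  obtain ⟨d, hd⟩ : ∃ d : ℝ, d = 1 / (2 * (G + 2)) := ⟨_, rfl⟩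
  have hd0 : 0 < d := by rw [hd]; positivity
  have hdG : d * (G + 2) = 1 / 2 := by rw [hd]; field_simp
  have hd4 : d ≤ 1 / 4 := by nlinarith
  refine ⟨d / (6 * (1 + G)), by positivity, ?_⟩
  have h : Tendsto (fun s : ℕ => Real.sqrt s) atTop atTop :=
    Real.tendsto_sqrt_atTop.comp tendsto_natCast_atTop_atTop
  filter_upwards [h.eventually_ge_atTop (1 / d), h.eventually_ge_atTop (G + 2),
    eventually_arrivalRate_pos G] with s hs hs2 hpos γ γ' hγ hγ' hle
  obtain ⟨hs1, hpos⟩ := hpos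
  have hx := hpos γ hγ
  have hy := hpos γ' hγ'
  obtain ⟨r, hr⟩ : ∃ r, r = Real.sqrt s := ⟨_, rfl⟩
  have hrr : r * r = s := by rw [hr]; exact Real.mul_self_sqrt (Nat.cast_nonneg _)
  rw [← hr] at hs hs2
  have hr0 : 0 < r := by linarith
  have hr1 : 1 ≤ r := by linarith
  have hdr : 1 ≤ d * r := by rw [div_le_iff₀ hd0] at hs; linarith
  obtain ⟨n, hn⟩ : ∃ n : ℕ, n = ⌊d * r⌋₊ := ⟨_, rfl⟩
  have hnle : (n : ℝ) ≤ d * r := by rw [hn]; exact Nat.floor_le (by positivity)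
  have hnge : d * r / 2 ≤ n := by
    have h1 : d * r < n + 1 := by rw [hn]; exact Nat.lt_floor_add_one _
    have h2 : (1 : ℝ) ≤ n := by
      rw [hn]; exact_mod_cast Nat.le_floor (by simpa using hdr)
    linarith
  have hrs : r ≤ s := by rw [← hrr]; nlinarith
  have hn2 : 2 * n ≤ s := by
    have : (2 * n : ℝ) ≤ s := by nlinarith
    exact_mod_cast this
  have hsub : arrivalRate s γ - arrivalRate s γ' = (γ' - γ) * r := by
    unfold arrivalRate; rw [← hr]; ring
  have hxle : ∀ g : ℝ, |g| ≤ G → arrivalRate s g ≤ s + G * r := by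
    intro g hg
    unfold arrivalRate; rw [← hr]
    nlinarith [neg_abs_le g]
  have hmom := belowRatio_le_moment (s := s) (n := n) (x := arrivalRate s γ) (t := (G + 2) / r)
    hx (by rw [div_le_one hr0]; exact hs2) hn2 (by
      calc (n : ℝ) * ((G + 2) / r) ≤ d * r * ((G + 2) / r) :=
            mul_le_mul_of_nonneg_right hnle (by positivity)
        _ = d * (G + 2) := by field_simp
        _ ≤ 1 / 2 := hdG.le) (by
      have h1 : (G + 2) / r ≤ 1 := by rw [div_le_one hr0]; exact hs2
      have h2 := mul_le_mul_of_nonneg_left (hxle γ hγ) (sub_nonneg.2 h1)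
      have h3 : (1 - (G + 2) / r) * (s + G * r) = s - 2 * r - (G + 2) * G := by
        rw [← hrr]; field_simp; ring
      have h4 : 0 ≤ (G + 2) * G := by positivity
      nlinarith)
  have hadd := belowRatio_add_moment_le (s := s) hy (x := arrivalRate s γ)
    (by have := mul_nonneg (sub_nonneg.2 hle) hr0.le; linarith)
  rw [hsub] at hadd
  have hA := (belowRatio_pos hs1 hx).le
  have hyle : arrivalRate s γ' ≤ (1 + G) * (r * r) := by
    have := hxle γ' hγ'
    nlinarith
  have hcoef : d / (6 * (1 + G)) * (γ' - γ)
      ≤ (γ' - γ) * r / arrivalRate s γ' * (n / 3) := by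
    have h1 : d / (6 * (1 + G)) ≤ r / arrivalRate s γ' * (n / 3) := by
      calc d / (6 * (1 + G)) = r / ((1 + G) * (r * r)) * (d * r / 2 / 3) := by
            field_simp; norm_num
        _ ≤ r / arrivalRate s γ' * (n / 3) := by gcongr
    calc _ ≤ r / arrivalRate s γ' * (n / 3) * (γ' - γ) :=
          mul_le_mul_of_nonneg_right h1 (sub_nonneg.2 hle)
      _ = _ := by ring
  have hfac : 0 ≤ (γ' - γ) * r / arrivalRate s γ' :=
    div_nonneg (mul_nonneg (sub_nonneg.2 hle) hr0.le) hy.le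
  have h5 := mul_le_mul_of_nonneg_left hmom hfac
  have h6 := mul_le_mul_of_nonneg_right hcoef hA
  nlinarith


/-! ### Closed form and regularity of the delay probability -/

lemma queueTerm_nonneg {p : ℕ → ℝ} (hp : ∀ k, 0 ≤ p k ∧ p k ≤ 1) {x : ℝ} (hx : 0 ≤ x) (n : ℕ) :
    0 ≤ queueTerm p x n :=
  mul_nonneg (Finset.prod_nonneg fun i _ => (hp i).1) (pow_nonneg hx _)

lemma queueTerm_mono {p : ℕ → ℝ} (hp : ∀ k, 0 ≤ p k ∧ p k ≤ 1) {x y : ℝ} (hx : 0 ≤ x)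
    (hxy : x ≤ y) (n : ℕ) : queueTerm p x n ≤ queueTerm p y n :=
  mul_le_mul_of_nonneg_left (pow_le_pow_left₀ hx hxy _) (Finset.prod_nonneg fun i _ => (hp i).1)

lemma summable_queueTerm_of_le {p : ℕ → ℝ} (hp : ∀ k, 0 ≤ p k ∧ p k ≤ 1) {x y : ℝ} (hx : 0 ≤ x)
    (hxy : x ≤ y) (hy : Summable (queueTerm p y)) : Summable (queueTerm p x) :=
  Summable.of_nonneg_of_le (queueTerm_nonneg hp hx) (queueTerm_mono hp hx hxy) hy

lemma load_anti (s : ℕ) {γ γ' : ℝ} (h : γ ≤ γ') : load s γ' ≤ load s γ := by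
  unfold load arrivalRate
  gcongr

lemma summable_of_gammaMin_lt {p : ℕ → ℝ} (hp : ∀ k, 0 ≤ p k ∧ p k ≤ 1) {s : ℕ} {γl γ : ℝ}
    (h : gammaMin p s < (γl : EReal)) (hγ : γl ≤ γ) (hload : 0 ≤ load s γ) :
    Summable (queueTerm p (load s γ)) := by
  obtain ⟨_, ⟨g, hg, rfl⟩, hlt⟩ := sInf_lt_iff.1 h
  have hlt' : g < γl := EReal.coe_lt_coe_iff.1 hlt
  exact summable_queueTerm_of_le hp hload (load_anti s (hlt'.le.trans hγ)) hg

lemma natCast_mul_load {s : ℕ} (hs : 1 ≤ s) (γ : ℝ) : (s : ℝ) * load s γ = arrivalRate s γ := by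
  have : (s : ℝ) ≠ 0 := by positivity
  unfold load; field_simp

lemma sum_range_pow_div_factorial (s : ℕ) {x : ℝ} (hx : 0 < x) :
    ∑ k ∈ Finset.range (s + 1), x ^ k / (k.factorial : ℝ)
      = x ^ s / (s.factorial : ℝ) * (1 + belowRatio s x) := by
  have h1 : ∀ m ∈ Finset.range (s + 1), x ^ (s + 1 - 1 - m) / ((s + 1 - 1 - m).factorial : ℝ)
      = x ^ s / (s.factorial : ℝ) * stateRatio s x m := by
    intro m hm
    have hm' : m ≤ s := by have := Finset.mem_range.1 hm; omega
    have hf : ((s - m).factorial : ℝ) * (s.descFactorial m : ℝ) = s.factorial := by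
      exact_mod_cast Nat.factorial_mul_descFactorial hm'
    have hpow : x ^ s = x ^ (s - m) * x ^ m := by rw [← pow_add]; congr 1; omega
    have h2 : ((s - m).factorial : ℝ) ≠ 0 := by positivity
    have h3 : (s.descFactorial m : ℝ) ≠ 0 := by
      have := (Nat.descFactorial_pos (n := s) (k := m)).2 hm'
      positivity
    rw [Nat.add_sub_cancel, stateRatio, ← hf, hpow]
    field_simp
  rw [← Finset.sum_range_reflect, Finset.sum_congr rfl h1, ← Finset.mul_sum,
    Finset.sum_range_succ']
  congr 1
  have h2 : ∑ m ∈ Finset.range s, stateRatio s x (m + 1) = belowRatio s x := by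
    rw [belowRatio, Finset.range_eq_Ico, Finset.sum_Ico_add' (stateRatio s x) 0 s 1]
    rfl
  rw [h2, add_comm]
  simp [stateRatio]

lemma delayProb_eq {p : ℕ → ℝ} {s : ℕ} (hs : 1 ≤ s) {γ : ℝ} (hpos : 0 < arrivalRate s γ)
    (hsum : Summable (queueTerm p (load s γ))) :
    delayProb p s γ = (1 + queueSeries p (load s γ))
      / (1 + belowRatio s (arrivalRate s γ) + queueSeries p (load s γ)) := by
  obtain ⟨x, hx⟩ : ∃ x, x = arrivalRate s γ := ⟨_, rfl⟩
  obtain ⟨e, he⟩ : ∃ e : ℝ, e = x ^ s / (s.factorial : ℝ) := ⟨_, rfl⟩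
  have hx0 : 0 < x := hx ▸ hpos
  have he0 : e ≠ 0 := by rw [he]; positivity
  have hsl : (s : ℝ) * load s γ = x := hx ▸ natCast_mul_load hs γ
  have hZ : normConst p s γ = e * (1 + belowRatio s x + queueSeries p (load s γ)) := by
    rw [normConst, hsl, sum_range_pow_div_factorial s hx0, ← he]; ring
  have hterm : ∀ n : ℕ, (if s ≤ n + (s + 1) then stationary p s γ (n + (s + 1)) else 0)
      = (normConst p s γ)⁻¹ * e * queueTerm p (load s γ) n := by
    intro n
    rw [if_pos (by omega), stationary, if_neg (by omega), queueTerm, he, ← hsl, mul_pow,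
      show n + (s + 1) - s = n + 1 by omega, show n + (s + 1) = s + (n + 1) by omega, pow_add]
    ring
  have hsum' : Summable fun n : ℕ =>
      (if s ≤ n + (s + 1) then stationary p s γ (n + (s + 1)) else 0) := by
    simp_rw [hterm]; exact hsum.mul_left _
  have hsumm := (summable_nat_add_iff
    (f := fun k : ℕ => if s ≤ k then stationary p s γ k else 0) (s + 1)).1 hsum'
  -- Only `k = s` survives here; it gives the `1` in `1 + F`.
  have hfin : ∑ k ∈ Finset.range (s + 1), (if s ≤ k then stationary p s γ k else 0)
      = (normConst p s γ)⁻¹ * e := by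
    rw [Finset.sum_range_succ, Finset.sum_eq_zero, zero_add, if_pos le_rfl, stationary,
      if_pos le_rfl, hsl, he]
    intro k hk
    rw [if_neg (by have := Finset.mem_range.1 hk; omega)]
  rw [delayProb, ← hsumm.sum_add_tsum_nat_add (s + 1), hfin]
  simp_rw [hterm]
  rw [tsum_mul_left, ← queueSeries, hZ, ← hx, mul_inv]
  field_simp

lemma continuousOn_delayProb {p : ℕ → ℝ} (hp : ∀ k, 0 ≤ p k ∧ p k ≤ 1) {s : ℕ} (hs : 1 ≤ s)
    {a b : ℝ} (hpos : ∀ γ ∈ Icc a b, 0 < arrivalRate s γ)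
    (hsum : ∀ γ ∈ Icc a b, Summable (queueTerm p (load s γ))) :
    ContinuousOn (delayProb p s) (Icc a b) := by
  have hload : ∀ γ ∈ Icc a b, 0 ≤ load s γ := fun γ hγ =>
    div_nonneg (hpos γ hγ).le (Nat.cast_nonneg _)
  have hrate : Continuous (arrivalRate s) := by unfold arrivalRate; fun_prop
  have hloadc : Continuous (load s) := by unfold load; fun_prop
  have hF : ContinuousOn (fun γ => queueSeries p (load s γ)) (Icc a b) := by
    rcases (Icc a b).eq_empty_or_nonempty with he | ⟨g, hg⟩
    · rw [he]; exact continuousOn_empty _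
    have ha : a ∈ Icc a b := left_mem_Icc.2 (hg.1.trans hg.2)
    -- Weierstrass test: the load is largest at the left endpoint.
    refine continuousOn_tsum (u := queueTerm p (load s a)) (fun n => ?_) (hsum a ha) ?_
    · exact (continuous_const.mul (hloadc.pow _)).continuousOn
    · intro n γ hγ
      rw [Real.norm_of_nonneg (queueTerm_nonneg hp (hload γ hγ) n)]
      exact queueTerm_mono hp (hload γ hγ) (load_anti s hγ.1) n
  have hA : ContinuousOn (fun γ => belowRatio s (arrivalRate s γ)) (Icc a b) := by
    refine continuousOn_finsetSum _ fun m _ => ?_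
    exact continuousOn_const.div (hrate.pow m).continuousOn
      fun γ hγ => (pow_pos (hpos γ hγ) m).ne'
  refine ContinuousOn.congr (f := fun γ => (1 + queueSeries p (load s γ))
      / (1 + belowRatio s (arrivalRate s γ) + queueSeries p (load s γ))) ?_
    fun γ hγ => delayProb_eq hs (hpos γ hγ) (hsum γ hγ)
  refine (continuousOn_const.add hF).div ((continuousOn_const.add hA).add hF) fun γ hγ => ?_
  have h1 := belowRatio_pos hs (hpos γ hγ)
  have h2 : 0 ≤ queueSeries p (load s γ) := tsum_nonneg (queueTerm_nonneg hp (hload γ hγ))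
  positivity

/-- Uniformly in large `s`, the odds against delay grow at least linearly at a relative rate. -/
lemma delayProb_regularity (p : ℕ → ℕ → ℝ) (hp : ∀ s k, 0 ≤ p s k ∧ p s k ≤ 1)
    (γl γr : ℝ) (hΓ : ∀ᶠ s : ℕ in atTop, gammaMin (p s) s < (γl : EReal)) :
    ∃ c : ℝ, 0 < c ∧ ∀ᶠ s : ℕ in atTop, ContinuousOn (delayProb (p s) s) (Icc γl γr) ∧
      (∀ γ ∈ Icc γl γr, 0 < delayProb (p s) s γ ∧ delayProb (p s) s γ < 1) ∧
      ∀ γ ∈ Icc γl γr, ∀ γ' ∈ Icc γl γr, γ ≤ γ' →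
        c * (γ' - γ) * ((1 - delayProb (p s) s γ) * delayProb (p s) s γ')
          ≤ delayProb (p s) s γ - delayProb (p s) s γ' := by
  obtain ⟨G, hGdef⟩ : ∃ G, G = max |γl| |γr| := ⟨_, rfl⟩
  have hG : ∀ γ ∈ Icc γl γr, |γ| ≤ G := fun γ hγ => hGdef ▸ abs_le_max_abs_abs hγ.1 hγ.2
  obtain ⟨c, hc, hgrow⟩ := belowRatio_growth G (hGdef ▸ (abs_nonneg γl).trans (le_max_left _ _))
  refine ⟨c, hc, ?_⟩
  filter_upwards [hgrow, hΓ, eventually_arrivalRate_pos G] with s hgrow hmin ⟨hs, hrate⟩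
  have hpos : ∀ γ ∈ Icc γl γr, 0 < arrivalRate s γ := fun γ hγ => hrate γ (hG γ hγ)
  have hload : ∀ γ ∈ Icc γl γr, 0 ≤ load s γ := fun γ hγ =>
    div_nonneg (hpos γ hγ).le (Nat.cast_nonneg _)
  have hsum : ∀ γ ∈ Icc γl γr, Summable (queueTerm (p s) (load s γ)) := fun γ hγ =>
    summable_of_gammaMin_lt (hp s) hmin hγ.1 (hload γ hγ)
  have hF0 : ∀ γ ∈ Icc γl γr, 0 ≤ queueSeries (p s) (load s γ) := fun γ hγ =>
    tsum_nonneg (queueTerm_nonneg (hp s) (hload γ hγ))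
  refine ⟨continuousOn_delayProb (hp s) hs hpos hsum, fun γ hγ => ?_, fun γ hγ γ' hγ' hle => ?_⟩
  · rw [delayProb_eq hs (hpos γ hγ) (hsum γ hγ)]
    have h1 := belowRatio_pos hs (hpos γ hγ)
    have h2 := hF0 γ hγ
    refine ⟨by positivity, ?_⟩
    rw [div_lt_one (by positivity)]
    linarith
  · rw [delayProb_eq hs (hpos γ hγ) (hsum γ hγ), delayProb_eq hs (hpos γ' hγ') (hsum γ' hγ')]
    have hA := belowRatio_pos hs (hpos γ hγ)
    have hA' := belowRatio_pos hs (hpos γ' hγ')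
    have hF := hF0 γ hγ
    have hF' := hF0 γ' hγ'
    have hFle : queueSeries (p s) (load s γ') ≤ queueSeries (p s) (load s γ) :=
      (hsum γ' hγ').tsum_le_tsum (queueTerm_mono (hp s) (hload γ' hγ') (load_anti s hle))
        (hsum γ hγ)
    have hg := hgrow γ γ' (hG γ hγ) (hG γ' hγ') hle
    generalize belowRatio s (arrivalRate s γ) = A at *
    generalize belowRatio s (arrivalRate s γ') = A' at *
    generalize queueSeries (p s) (load s γ) = F at *
    generalize queueSeries (p s) (load s γ') = F' at *
    have h1 : 1 - (1 + F) / (1 + A + F) = A / (1 + A + F) := by field_simp; ring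
    rw [h1, div_mul_div_comm, div_sub_div _ _ (by positivity) (by positivity), mul_div_assoc']
    refine div_le_div_of_nonneg_right ?_ (by positivity)
    -- The numerator on the right is `A' (1 + F) - A (1 + F')`.
    have h2 := mul_le_mul_of_nonneg_right hg (by linarith : 0 ≤ 1 + F')
    have h3 := mul_le_mul_of_nonneg_left hFle hA'.le
    nlinarith


/-! ### Inverting the asymptotic expansion -/

lemma tendsto_div_natCast_rpow (C : ℝ) {a : ℝ} (ha : 0 < a) :
    Tendsto (fun s : ℕ => C / (s : ℝ) ^ a) atTop (nhds 0) :=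
  tendsto_const_nhds.div_atTop ((tendsto_rpow_atTop ha).comp tendsto_natCast_atTop_atTop)

lemma truncatedExpansion_eq (D : ℕ → ℝ → ℝ) (j s : ℕ) (γ : ℝ) :
    truncatedExpansion D j s γ
      = ∑ i ∈ Finset.range j, D (i + 1) γ / (s : ℝ) ^ (((i + 1 : ℕ) : ℝ) / 2) + D 0 γ := by
  rw [truncatedExpansion, Finset.sum_range_succ']
  simp

lemma tendsto_correction (L : ℕ → ℝ) (j : ℕ) :
    Tendsto (fun s : ℕ => ∑ i ∈ Finset.range j, L (i + 1) / (s : ℝ) ^ (((i + 1 : ℕ) : ℝ) / 2))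
      atTop (nhds 0) := by
  have := tendsto_finsetSum (Finset.range j) fun i _ =>
    tendsto_div_natCast_rpow (L (i + 1)) (a := ((i + 1 : ℕ) : ℝ) / 2) (by positivity)
  simpa using this

lemma exists_lipschitz_bound {f : ℝ → ℝ} {a b : ℝ} (hf : DifferentiableOn ℝ f (Icc a b))
    (hb : ∃ C : ℝ, ∀ x ∈ Icc a b, |derivWithin f (Icc a b) x| ≤ C) :
    ∃ L : ℝ, ∀ x ∈ Icc a b, ∀ y ∈ Icc a b, |f x - f y| ≤ L * |x - y| := by
  obtain ⟨C, hC⟩ := hb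
  exact ⟨C, fun x hx y hy =>
    (convex_Icc a b).norm_image_sub_le_of_norm_derivWithin_le hf hC hy hx⟩

/-- Functions that satisfy a uniform logistic decrease and have a uniform asymptotic expansion
attain each value of the leading term at unique points, which the expansion approximates. -/
theorem exists_approximate_solution (g : ℕ → ℝ → ℝ) (γl γr c : ℝ) (hc : 0 < c)
    (hg : ∀ᶠ s : ℕ in atTop, ContinuousOn (g s) (Icc γl γr) ∧
      (∀ γ ∈ Icc γl γr, 0 < g s γ ∧ g s γ < 1) ∧
      ∀ γ ∈ Icc γl γr, ∀ γ' ∈ Icc γl γr, γ ≤ γ' →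
        c * (γ' - γ) * ((1 - g s γ) * g s γ') ≤ g s γ - g s γ')
    (ε : ℝ) (hε : ε ∈ Ioo (0 : ℝ) 1) (j : ℕ) (D : ℕ → ℝ → ℝ)
    (hexp : ∃ C : ℝ, ∀ᶠ s : ℕ in atTop, ∀ γ ∈ Icc γl γr,
      |g s γ - truncatedExpansion D j s γ| ≤ C / (s : ℝ) ^ (((j : ℝ) + 1) / 2))
    (hdiff : ∀ i ≤ j, DifferentiableOn ℝ (D i) (Icc γl γr))
    (hbdd : ∀ i ≤ j, ∃ C : ℝ, ∀ γ ∈ Icc γl γr, |derivWithin (D i) (Icc γl γr) γ| ≤ C)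
    (γ₀ : ℝ) (hγ₀ : γ₀ ∈ Ioo γl γr) (hDγ₀ : D 0 γ₀ = ε) :
    ∃ M : ℝ, 0 < M ∧ ∃ K : ℝ, 0 < K ∧ ∃ sj : ℕ, 1 ≤ sj ∧ ∀ s : ℕ, sj ≤ s →
      ∃ γj γstar : ℝ,
        IsUniqueSolution (truncatedExpansion D j s) (Icc γl γr) ε γj ∧
        IsUniqueSolution (g s) (Icc γl γr) ε γstar ∧
        |g s γj - ε| ≤ M / (s : ℝ) ^ (((j : ℝ) + 1) / 2) ∧
        |γj - γstar| ≤ K / (s : ℝ) ^ (((j : ℝ) + 1) / 2) := by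
  obtain ⟨hε0, hε1⟩ := hε
  obtain ⟨C, hexp⟩ := hexp
  have hlip : ∀ i, ∃ L : ℝ, i ≤ j → ∀ x ∈ Icc γl γr, ∀ y ∈ Icc γl γr,
      |D i x - D i y| ≤ L * |x - y| := by
    intro i
    by_cases hi : i ≤ j
    · obtain ⟨L, hL⟩ := exists_lipschitz_bound (hdiff i hi) (hbdd i hi)
      exact ⟨L, fun _ => hL⟩
    · exact ⟨0, fun h => absurd h hi⟩
  choose L hL using hlip
  have hbd : ∀ i, ∃ B : ℝ, i ≤ j → ∀ x ∈ Icc γl γr, |D i x| ≤ B := by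
    intro i
    by_cases hi : i ≤ j
    · obtain ⟨B, hB⟩ := isCompact_Icc.exists_bound_of_continuousOn (hdiff i hi).continuousOn
      exact ⟨B, fun _ => hB⟩
    · exact ⟨0, fun h => absurd h hi⟩
  choose B hB using hbd
  have htrunc : ∀ δ > 0, ∀ᶠ s : ℕ in atTop, ∀ γ ∈ Icc γl γr,
      |truncatedExpansion D j s γ - D 0 γ| < δ := by
    intro δ hδ
    filter_upwards [(tendsto_correction B j).eventually_lt_const hδ] with s hs γ hγ
    refine lt_of_le_of_lt ?_ hs
    rw [truncatedExpansion_eq, add_sub_cancel_right]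
    refine (Finset.abs_sum_le_sum_abs _ _).trans (Finset.sum_le_sum fun i hi => ?_)
    have hw : 0 ≤ (s : ℝ) ^ (((i + 1 : ℕ) : ℝ) / 2) := by positivity
    rw [abs_div, abs_of_nonneg hw]
    exact div_le_div_of_nonneg_right
      (hB (i + 1) (by have := Finset.mem_range.1 hi; omega) γ hγ) hw
  have hconv : ∀ δ > 0, ∀ᶠ s : ℕ in atTop, ∀ γ ∈ Icc γl γr, |g s γ - D 0 γ| < δ := by
    intro δ hδ
    have h0 := (tendsto_div_natCast_rpow C (a := ((j : ℝ) + 1) / 2)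
      (by positivity)).eventually_lt_const (half_pos hδ)
    filter_upwards [htrunc (δ / 2) (half_pos hδ), hexp, h0] with s h1 h2 h3 γ hγ
    have h4 := h1 γ hγ
    have h5 := h2 γ hγ
    rw [abs_lt] at h4 ⊢
    rw [abs_le] at h5
    constructor <;> linarith
  have hlim : ∀ γ ∈ Icc γl γr, Tendsto (fun s => g s γ) atTop (nhds (D 0 γ)) := by
    intro γ hγ
    rw [Metric.tendsto_atTop']
    intro δ hδ
    obtain ⟨N, hN⟩ := eventually_atTop.1 (hconv δ hδ)
    exact ⟨N, fun s hs => hN s hs.le γ hγ⟩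
  have hrange : ∀ γ ∈ Icc γl γr, 0 ≤ D 0 γ ∧ D 0 γ ≤ 1 := fun γ hγ =>
    ⟨ge_of_tendsto (hlim γ hγ) (hg.mono fun s h => (h.2.1 γ hγ).1.le),
      le_of_tendsto (hlim γ hγ) (hg.mono fun s h => (h.2.1 γ hγ).2.le)⟩
  have hlog : ∀ γ ∈ Icc γl γr, ∀ γ' ∈ Icc γl γr, γ ≤ γ' →
      c * (γ' - γ) * ((1 - D 0 γ) * D 0 γ') ≤ D 0 γ - D 0 γ' := fun γ hγ γ' hγ' hle =>
    le_of_tendsto_of_tendsto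
      (((tendsto_const_nhds.sub (hlim γ hγ)).mul (hlim γ' hγ')).const_mul _)
      ((hlim γ hγ).sub (hlim γ' hγ')) (hg.mono fun s h => h.2.2 γ hγ γ' hγ' hle)
  have hanti : ∀ γ ∈ Icc γl γr, ∀ γ' ∈ Icc γl γr, γ ≤ γ' → D 0 γ' ≤ D 0 γ := by
    intro γ hγ γ' hγ' hle
    have h1 := hlog γ hγ γ' hγ' hle
    have h2 : 0 ≤ c * (γ' - γ) * ((1 - D 0 γ) * D 0 γ') :=
      mul_nonneg (mul_nonneg hc.le (sub_nonneg.2 hle))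
        (mul_nonneg (sub_nonneg.2 (hrange γ hγ).2) (hrange γ' hγ').1)
    linarith
  have hmem₀ : γ₀ ∈ Icc γl γr := Ioo_subset_Icc_self hγ₀
  -- a neighbourhood of `γ₀` on which the leading term stays away from `0` and `1`
  have hcont₀ : ContinuousAt (D 0) γ₀ :=
    (hdiff 0 (Nat.zero_le _)).continuousOn.continuousAt (Icc_mem_nhds hγ₀.1 hγ₀.2)
  have hnear : ∀ᶠ γ in nhds γ₀, γ ∈ Icc γl γr ∧ D 0 γ ∈ Ioo (ε / 2) ((1 + ε) / 2) :=
    Filter.Eventually.and (Icc_mem_nhds hγ₀.1 hγ₀.2)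
      (hcont₀ (Ioo_mem_nhds (by linarith) (by linarith)))
  obtain ⟨η, hη, hball⟩ := Metric.nhds_basis_closedBall.eventually_iff.1 hnear
  rw [Real.closedBall_eq_Icc] at hball
  obtain ⟨a, ha⟩ : ∃ a, a = γ₀ - η := ⟨_, rfl⟩
  obtain ⟨b, hb⟩ : ∃ b, b = γ₀ + η := ⟨_, rfl⟩
  rw [← ha, ← hb] at hball
  have haI : a ∈ Icc a b := ⟨le_rfl, by linarith⟩
  have hbI : b ∈ Icc a b := ⟨by linarith, le_rfl⟩
  have haΓ := (hball haI).1
  have hbΓ := (hball hbI).1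
  have ha0 := (hball haI).2
  have hb0 := (hball hbI).2
  have hDa : ε < D 0 a := by
    have h1 := hlog a haΓ γ₀ hmem₀ (by linarith)
    rw [hDγ₀] at h1
    have h2 : 0 < c * (γ₀ - a) * ((1 - D 0 a) * ε) :=
      mul_pos (mul_pos hc (by linarith)) (mul_pos (by linarith [ha0.2]) hε0)
    linarith
  have hDb : D 0 b < ε := by
    have h1 := hlog γ₀ hmem₀ b hbΓ (by linarith)
    rw [hDγ₀] at h1
    have h2 : 0 < c * (b - γ₀) * ((1 - ε) * D 0 b) :=
      mul_pos (mul_pos hc (by linarith)) (mul_pos (by linarith) (by linarith [hb0.1]))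
    linarith
  obtain ⟨m, hm0, hma, hmb⟩ : ∃ m > 0, m ≤ D 0 a - ε ∧ m ≤ ε - D 0 b :=
    ⟨min (D 0 a - ε) (ε - D 0 b), lt_min (by linarith) (by linarith),
      min_le_left _ _, min_le_right _ _⟩
  -- a function close to the leading term takes the value `ε` only in that neighbourhood
  have hlocal : ∀ f : ℝ → ℝ, ContinuousOn f (Icc γl γr) →
      (∀ γ ∈ Icc γl γr, |f γ - D 0 γ| < m) →
      (∀ x ∈ Icc a b, ∀ y ∈ Icc a b, x < y → f y < f x) →
      ∃ x ∈ Icc a b, IsUniqueSolution f (Icc γl γr) ε x := by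
    intro f hf hclose hf'
    have hsub : Icc a b ⊆ Icc γl γr := fun x hx => (hball hx).1
    have h1 := abs_lt.1 (hclose a haΓ)
    have h2 := abs_lt.1 (hclose b hbΓ)
    obtain ⟨x, hx, hfx⟩ := intermediate_value_Icc' (by linarith : a ≤ b) (hf.mono hsub)
      (show ε ∈ Icc (f b) (f a) from ⟨by linarith [h2.2], by linarith [h1.1]⟩)
    refine ⟨x, hx, hsub hx, hfx, fun y hy hfy => ?_⟩
    have h3 := abs_lt.1 (hclose y hy)
    -- Outside `[a, b]`, monotonicity keeps `D 0` at least `m` away from `ε`.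
    have hyI : y ∈ Icc a b := by
      constructor
      · by_contra! h
        have := hanti y hy a haΓ h.le
        linarith [h3.1, h3.2]
      · by_contra! h
        have := hanti b hbΓ y hy h.le
        linarith [h3.1, h3.2]
    rcases lt_trichotomy x y with h | h | h
    · have := hf' x hx y hyI h; linarith
    · exact h.symm
    · have := hf' y hyI x hx h; linarith
  -- On `[a, b]`, `1 - D 0 ≥ (1 - ε) / 2` and `D 0 ≥ ε / 2`; closeness of `f` costs at most half of
  -- each bound.
  obtain ⟨q, hq⟩ : ∃ q, q = c * ((1 - ε) / 4 * (ε / 4)) := ⟨_, rfl⟩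
  have hε1' : 0 < 1 - ε := by linarith
  have hq0 : 0 < q := by rw [hq]; positivity
  have hslope : ∀ f : ℝ → ℝ, (∀ x ∈ Icc a b, ∀ y ∈ Icc a b, x ≤ y →
        c * (y - x) * ((1 - f x) * f y) ≤ f x - f y) →
      (∀ x ∈ Icc a b, |f x - D 0 x| ≤ min (ε / 4) ((1 - ε) / 4)) →
      ∀ x ∈ Icc a b, ∀ y ∈ Icc a b, x ≤ y → q * (y - x) ≤ f x - f y := by
    intro f hf hclose x hx y hy hxy
    refine le_trans ?_ (hf x hx y hy hxy)
    have h1 := (abs_le.1 ((hclose x hx).trans (min_le_right _ _))).2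
    have h2 := (abs_le.1 ((hclose y hy).trans (min_le_left _ _))).1
    have h3 : (1 - ε) / 4 * (ε / 4) ≤ (1 - f x) * f y :=
      mul_le_mul (by linarith [(hball hx).2.2]) (by linarith [(hball hy).2.1])
        (by linarith) (by linarith [(hball hx).2.2])
    have h4 := mul_le_mul_of_nonneg_left h3 (mul_nonneg hc.le (sub_nonneg.2 hxy))
    rw [hq]
    linarith
  have hmin : 0 < min (ε / 4) ((1 - ε) / 4) := lt_min (by linarith) (by linarith)
  have hslope₀ := hslope (D 0) (fun x hx y hy => hlog x (hball hx).1 y (hball hy).1)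
    (fun x _ => by simpa using hmin.le)
  obtain ⟨M, hM0, hCM⟩ : ∃ M : ℝ, 0 < M ∧ C ≤ M :=
    ⟨max C 1, lt_max_of_lt_right one_pos, le_max_left _ _⟩
  refine ⟨M, hM0, M / q, div_pos hM0 hq0, ?_⟩
  have hev : ∀ᶠ s : ℕ in atTop, ∃ γj γstar : ℝ,
        IsUniqueSolution (truncatedExpansion D j s) (Icc γl γr) ε γj ∧
        IsUniqueSolution (g s) (Icc γl γr) ε γstar ∧
        |g s γj - ε| ≤ M / (s : ℝ) ^ (((j : ℝ) + 1) / 2) ∧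
        |γj - γstar| ≤ M / q / (s : ℝ) ^ (((j : ℝ) + 1) / 2) := by
    filter_upwards [hg, hexp, htrunc m hm0, hconv m hm0, hconv _ hmin,
      (tendsto_correction L j).eventually_lt_const hq0] with s ⟨hgc, _, hgl⟩ hs htm hgm hgmin hcor
    have hgs := hslope (g s) (fun x hx y hy => hgl x (hball hx).1 y (hball hy).1)
      (fun x hx => (hgmin x (hball hx).1).le)
    obtain ⟨x, hx, hxu⟩ := hlocal (g s) hgc hgm fun x hx y hy hxy => by
      have h1 := hgs x hx y hy hxy.le
      have h2 := mul_pos hq0 (sub_pos.2 hxy)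
      linarith
    have htc : ContinuousOn (truncatedExpansion D j s) (Icc γl γr) :=
      continuousOn_finsetSum _ fun i hi => ContinuousOn.div_const
        (hdiff i (by have := Finset.mem_range.1 hi; omega)).continuousOn _
    obtain ⟨y, hy, hyu⟩ := hlocal (truncatedExpansion D j s) htc htm fun x hx y hy hxy => by
      have h1 := hslope₀ x hx y hy hxy.le
      have h2 : ∑ i ∈ Finset.range j, D (i + 1) y / (s : ℝ) ^ (((i + 1 : ℕ) : ℝ) / 2)
          - ∑ i ∈ Finset.range j, D (i + 1) x / (s : ℝ) ^ (((i + 1 : ℕ) : ℝ) / 2)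
          ≤ (∑ i ∈ Finset.range j, L (i + 1) / (s : ℝ) ^ (((i + 1 : ℕ) : ℝ) / 2)) * (y - x) := by
        rw [← Finset.sum_sub_distrib, Finset.sum_mul]
        refine Finset.sum_le_sum fun i hi => ?_
        rw [← sub_div, div_mul_eq_mul_div]
        refine div_le_div_of_nonneg_right ?_ (by positivity)
        have := hL (i + 1) (by have := Finset.mem_range.1 hi; omega) y (hball hy).1 x (hball hx).1
        rw [abs_of_pos (sub_pos.2 hxy)] at this
        exact (le_abs_self _).trans this
      have h3 := mul_lt_mul_of_pos_right hcor (sub_pos.2 hxy)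
      rw [truncatedExpansion_eq, truncatedExpansion_eq]
      linarith
    have hw : 0 ≤ (s : ℝ) ^ (((j : ℝ) + 1) / 2) := by positivity
    have hMbound : |g s y - ε| ≤ M / (s : ℝ) ^ (((j : ℝ) + 1) / 2) := by
      have h1 := hs y hyu.1
      rw [hyu.2.1] at h1
      exact h1.trans (div_le_div_of_nonneg_right hCM hw)
    refine ⟨y, x, hyu, hxu, hMbound, ?_⟩
    -- The slope bound gives `q |y - x| ≤ |g s y - g s x|`, and `g s x = ε`.
    rw [div_right_comm, le_div_iff₀ hq0]
    refine le_trans ?_ hMbound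
    rw [← hxu.2.1]
    rcases le_total x y with h | h
    · have h1 := hgs x hx y hy h
      rw [abs_of_nonneg (sub_nonneg.2 h), abs_sub_comm]
      exact le_trans (by linarith) (le_abs_self _)
    · have h1 := hgs y hy x hx h
      rw [abs_sub_comm, abs_of_nonneg (sub_nonneg.2 h)]
      exact le_trans (by linarith) (le_abs_self _)
  obtain ⟨N, hN⟩ := eventually_atTop.1 hev
  exact ⟨max N 1, le_max_right _ _, fun s hs => hN s ((le_max_left _ _).trans hs)⟩

end AdmissionQueue

open AdmissionQueue in
theorem mainTheorem3
    (p : ℕ → ℕ → ℝ) (hp : ∀ s k, 0 ≤ p s k ∧ p s k ≤ 1)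
    (γl γr : ℝ) (hΓ : ∀ᶠ s : ℕ in atTop, gammaMin (p s) s < (γl : EReal))
    (ε : ℝ) (hε : ε ∈ Ioo (0 : ℝ) 1)
    (j : ℕ) (D : ℕ → ℝ → ℝ)
    (hexp : ∃ C : ℝ, ∀ᶠ s : ℕ in atTop, ∀ γ ∈ Icc γl γr,
      |delayProb (p s) s γ - truncatedExpansion D j s γ| ≤ C / (s : ℝ) ^ (((j : ℝ) + 1) / 2))
    (hdiff : ∀ i ≤ j, DifferentiableOn ℝ (D i) (Icc γl γr))
    (hbdd : ∀ i ≤ j, ∃ C : ℝ, ∀ γ ∈ Icc γl γr, |derivWithin (D i) (Icc γl γr) γ| ≤ C)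
    (γ₀ : ℝ) (hγ₀ : γ₀ ∈ Ioo γl γr) (hDγ₀ : D 0 γ₀ = ε) :
    ∃ M : ℝ, 0 < M ∧ ∃ K : ℝ, 0 < K ∧ ∃ sj : ℕ, 1 ≤ sj ∧ ∀ s : ℕ, sj ≤ s →
      ∃ γj γstar : ℝ,
        IsUniqueSolution (truncatedExpansion D j s) (Icc γl γr) ε γj ∧
        IsUniqueSolution (delayProb (p s) s) (Icc γl γr) ε γstar ∧
        |delayProb (p s) s γj - ε| ≤ M / (s : ℝ) ^ (((j : ℝ) + 1) / 2) ∧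
        |γj - γstar| ≤ K / (s : ℝ) ^ (((j : ℝ) + 1) / 2) := by
  obtain ⟨c, hc, hreg⟩ := delayProb_regularity p hp γl γr hΓ
  exact exists_approximate_solution (fun s => delayProb (p s) s) γl γr c hc hreg ε hε j D hexp
    hdiff hbdd γ₀ hγ₀ hDγ₀
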